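/- An $n\times n$ bimatrix game is a pair $(R,C)$ of matrices $R,C\in[0,1]^{n\times n}$ ($n\ge 1$). A profile $(x,y)$ of mixed strategies (probability vectors on $[n]=\{1,\dots,n\}$) is a $\delta$-well-supported Nash equilibrium ($\delta$-WSNE) if $\max_{i'}(Ry)_{i'}-(Ry)_i\le\delta$ for every $i$ with $x_i>0$ and $\max_{j'}(x^{T}C)_{j'}-(x^{T}C)_j\le\delta$ for every $j$ with $y_j>0$. A randomized payoff query algorithm for $n\times n$ games does not know $R$ and $C$; it adaptively proposes pure profiles $(i,j)$ and is told $R_{ij}$ and $C_{ij}$ (one payoff query), may make arbitrary computations and random choices before, between and after its queries, and finally outputs a mixed strategy profile. For every constant $c>0$ there are a constant $K$ and a family of randomized payoff query algorithms $A_{n,\varepsilon}$ ($n\ge 1$, $\varepsilon>0$) such that, for all $n\ge1$, all $\varepsilon>0$ and every $n\times n$ bimatrix game $(R,C)$ with payoffs in $[0,1]$, the algorithm $A_{n,\varepsilon}$ run on $(R,C)$ always makes at most $K\cdot\frac{n\log n}{\varepsilon^{2}}$ payoff queries and, with probability at least $1-n^{-c}$, outputs a $(0.6528+\varepsilon)$-WSNE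 of $(R,C)$. -/

import Mathlib

/-- An `n × n` bimatrix game: payoff matrices of the row and the column player, with all payoffs
in `[0, 1]`. -/
structure BimatrixGame (n : ℕ) where
  /-- payoffs of the row player -/
  R : Matrix (Fin n) (Fin n) ℝ
  /-- payoffs of the column player -/
  C : Matrix (Fin n) (Fin n) ℝ
  R_mem : ∀ i j, R i j ∈ Set.Icc (0 : ℝ) 1
  C_mem : ∀ i j, C i j ∈ Set.Icc (0 : ℝ) 1

/-- A mixed strategy: a probability vector over the `n` pure strategies. -/
abbrev MixedStrategy (n : ℕ) : Type := stdSimplex ℝ (Fin n)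

namespace BimatrixGame

variable {n : ℕ}

/-- `(R y)_i`: the payoff of the pure row `i` against the column player's mixed strategy `y`. -/
noncomputable def rowPayoff (G : BimatrixGame n) (y : MixedStrategy n) (i : Fin n) : ℝ :=
  ∑ j, G.R i j * y.1 j

/-- `(xᵀ C)_j`: the payoff of the pure column `j` against the row player's mixed strategy `x`. -/
noncomputable def colPayoff (G : BimatrixGame n) (x : MixedStrategy n) (j : Fin n) : ℝ :=
  ∑ i, x.1 i * G.C i j

/-- Row `i` is a `δ`-best response against `y`. The supremum is a maximum, the index set
being finite (and non-empty, since it contains `i`). -/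
def IsRowApproxBestResponse (G : BimatrixGame n) (δ : ℝ) (y : MixedStrategy n) (i : Fin n) :
    Prop :=
  (⨆ i', G.rowPayoff y i') - G.rowPayoff y i ≤ δ

/-- Column `j` is a `δ`-best response against `x`. -/
def IsColApproxBestResponse (G : BimatrixGame n) (δ : ℝ) (x : MixedStrategy n) (j : Fin n) :
    Prop :=
  (⨆ j', G.colPayoff x j') - G.colPayoff x j ≤ δ

/-- `(x, y)` is a `δ`-well-supported Nash equilibrium: both players place positive probability
only on `δ`-best responses. -/
def IsWSNE (G : BimatrixGame n) (δ : ℝ) (x y : MixedStrategy n) : Prop :=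
  (∀ i, 0 < x.1 i → G.IsRowApproxBestResponse δ y i) ∧
  (∀ j, 0 < y.1 j → G.IsColApproxBestResponse δ x j)

end BimatrixGame

/-- A randomized algorithm in the payoff query model for `n × n` bimatrix games, as a randomized
adaptive decision tree. It sees the payoffs only through its queries; between queries it may make
arbitrary computations (the dependence of the next step on the answers is an arbitrary function)
and random choices. Every run is finite. -/
inductive PayoffQueryAlgorithm (n : ℕ) : Type
  /-- Stop and return the mixed strategy profile `(x, y)`. -/
  | output (x y : MixedStrategy n) : PayoffQueryAlgorithm n
  /-- Query the pure profile `(i, j)`; go on with `next r c`, where `r` and `c` are the payoffs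
  of the row and the column player under `(i, j)`. -/
  | query (i j : Fin n) (next : ℝ → ℝ → PayoffQueryAlgorithm n) : PayoffQueryAlgorithm n
  /-- Draw `a` from the distribution `p`, independently of everything before, and go on with
  `next a`. -/
  | sample (m : ℕ) (p : PMF (Fin m)) (next : Fin m → PayoffQueryAlgorithm n) :
      PayoffQueryAlgorithm n

/-- What a run of a payoff query algorithm leaves behind: the returned mixed strategy profile and
the number of payoff queries made. -/
structure QueryOutcome (n : ℕ) where
  /-- the returned strategy of the row player -/
  x : MixedStrategy n
  /-- the returned strategy of the column player -/
  y : MixedStrategy n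
  /-- the number of payoff queries made -/
  queries : ℕ

/-- The distribution of the outcome of the algorithm on the game `G`. -/
noncomputable def PayoffQueryAlgorithm.run {n : ℕ} (G : BimatrixGame n) :
    PayoffQueryAlgorithm n → PMF (QueryOutcome n)
  | .output x y => PMF.pure ⟨x, y, 0⟩
  | .query i j next =>
      (run G (next (G.R i j) (G.C i j))).map fun o => ⟨o.x, o.y, o.queries + 1⟩
  | .sample _ p next => p.bind fun a => run G (next a)

/-! A WSNE of the fixed quality 0.6528 already follows from approximate solutions, with duality gap
at most 0.001, of the two zero-sum games given by `R` and by `C`. Constant accuracy needs only order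
`log n` rounds of multiplicative weights, and a round costs `2 * n` queries. Thus `ε` plays no role
beyond the case `1 ≤ ε`, where every profile is good enough.

Existence (`exists_isCertifiedWSNE`): if both approximate values are at most 0.6528, each player can
be held below 0.6528, and combining the two holding strategies leaves no regret above 0.6528.
Otherwise, up to exchanging the players, the row player can secure about 0.65. After discarding bad
rows, either no column earns more than 0.6528, or some column `p` does
(`exists_isCertifiedWSNE_of_secure`). Then one of three things is stable: a pure profile where both
earn at least 0.3472, the column `p` against the rows that do well in it, or a uniformly mixed 2 × 2
subgame resembling matching pennies.

The algorithm sees only part of the game, so the equilibrium must be certified: valid in all games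
consistent with the answers. Such a profile is recognisable from the table alone, and
`outputCertified` picks one.

Probability: the product of the two players' exponential potentials starts at `n ^ 2`, grows in
expectation by a factor of at most `(1 + α ^ 2) ^ 2` per round (`sum_softmax_mul_potential_le`), and
is exponentially large whenever the gap is large (`exp_gap_le_potential`). Markov's inequality,
carried through the decision tree in `failProb_zeroSumRounds_le`, does the rest. -/

namespace MixedStrategy

/-! ### Conditioned and empirical mixed strategies. -/

/-- The mixed strategy `x` conditioned on the set `Q` of pure strategies. -/
noncomputable def conditioned {n : ℕ} (x : MixedStrategy n) (Q : Finset (Fin n))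
    (h : 0 < ∑ i ∈ Q, x.1 i) : MixedStrategy n :=
  ⟨fun i => if i ∈ Q then x.1 i / ∑ k ∈ Q, x.1 k else 0, by
    constructor
    · intro i
      dsimp only
      split_ifs
      · exact div_nonneg (x.2.1 i) h.le
      · exact le_rfl
    · rw [Finset.sum_ite_mem, Finset.univ_inter, ← Finset.sum_div, div_self h.ne']⟩

lemma sum_conditioned_mul {n : ℕ} (x : MixedStrategy n) (Q : Finset (Fin n))
    (h : 0 < ∑ i ∈ Q, x.1 i) (f : Fin n → ℝ) :
    ∑ i, (x.conditioned Q h).1 i * f i = (∑ i ∈ Q, x.1 i * f i) / ∑ i ∈ Q, x.1 i := by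
  simp only [conditioned, ite_mul, zero_mul]
  rw [Finset.sum_ite_mem, Finset.univ_inter, Finset.sum_div]
  exact Finset.sum_congr rfl fun i _ => by ring

lemma mem_of_conditioned_pos {n : ℕ} {x : MixedStrategy n} {Q : Finset (Fin n)}
    {h : 0 < ∑ i ∈ Q, x.1 i} {i : Fin n} (hi : 0 < (x.conditioned Q h).1 i) :
    i ∈ Q ∧ 0 < x.1 i := by
  simp only [conditioned] at hi
  split_ifs at hi with hQ
  · exact ⟨hQ, (div_pos_iff_of_pos_right h).1 hi⟩
  · exact absurd hi (lt_irrefl _)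

lemma sum_count_mul {n : ℕ} (L : List (Fin n)) (f : Fin n → ℝ) :
    ∑ i, (L.count i : ℝ) * f i = (L.map f).sum := by
  induction L with
  | nil => simp
  | cons a L ih =>
    simp only [List.count_cons, List.map_cons, List.sum_cons, Nat.cast_add, add_mul,
      Finset.sum_add_distrib, ih]
    simp [add_comm]

/-- The uniform distribution over a nonempty list of pure strategies. -/
noncomputable def empirical {n : ℕ} (L : List (Fin n)) (h : L ≠ []) : MixedStrategy n :=
  ⟨fun i => (L.count i : ℝ) / L.length, by
    have hL : (0 : ℝ) < L.length := by exact_mod_cast List.length_pos_iff.2 h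
    constructor
    · intro i
      positivity
    · rw [← Finset.sum_div, div_eq_one_iff_eq hL.ne']
      simpa using sum_count_mul L fun _ => 1⟩

lemma sum_empirical_mul {n : ℕ} (L : List (Fin n)) (h : L ≠ []) (f : Fin n → ℝ) :
    ∑ i, (empirical L h).1 i * f i = (L.map f).sum / L.length := by
  rw [← sum_count_mul, Finset.sum_div]
  exact Finset.sum_congr rfl fun i _ => by simp only [empirical]; ring

lemma mem_of_empirical_pos {n : ℕ} {L : List (Fin n)} {h : L ≠ []} {i : Fin n}
    (hi : 0 < (empirical L h).1 i) : i ∈ L := by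
  by_contra hL
  simp [empirical, List.count_eq_zero_of_not_mem hL] at hi

end MixedStrategy

namespace BimatrixGame

/-! ### Symmetry, payoff bounds and certified equilibria. -/

/-- The game with the roles of the two players exchanged. -/
def swap {n : ℕ} (G : BimatrixGame n) : BimatrixGame n where
  R := G.C.transpose
  C := G.R.transpose
  R_mem i j := G.C_mem j i
  C_mem i j := G.R_mem j i

lemma rowPayoff_swap {n : ℕ} (G : BimatrixGame n) (x : MixedStrategy n) (j : Fin n) :
    G.swap.rowPayoff x j = G.colPayoff x j :=
  Finset.sum_congr rfl fun _ _ => mul_comm _ _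

lemma colPayoff_swap {n : ℕ} (G : BimatrixGame n) (y : MixedStrategy n) (i : Fin n) :
    G.swap.colPayoff y i = G.rowPayoff y i :=
  Finset.sum_congr rfl fun _ _ => mul_comm _ _

lemma isWSNE_swap {n : ℕ} {G : BimatrixGame n} {δ : ℝ} {x y : MixedStrategy n} :
    G.swap.IsWSNE δ y x ↔ G.IsWSNE δ x y := by
  simp only [IsWSNE, IsRowApproxBestResponse, IsColApproxBestResponse, rowPayoff_swap,
    colPayoff_swap]
  exact and_comm

lemma rowPayoff_nonneg {n : ℕ} (G : BimatrixGame n) (y : MixedStrategy n) (i : Fin n) :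
    0 ≤ G.rowPayoff y i :=
  Finset.sum_nonneg fun j _ => mul_nonneg (G.R_mem i j).1 (y.2.1 j)

lemma rowPayoff_le_one {n : ℕ} (G : BimatrixGame n) (y : MixedStrategy n) (i : Fin n) :
    G.rowPayoff y i ≤ 1 :=
  (Finset.sum_le_sum fun j _ => mul_le_of_le_one_left (y.2.1 j) (G.R_mem i j).2).trans y.2.2.le

lemma colPayoff_nonneg {n : ℕ} (G : BimatrixGame n) (x : MixedStrategy n) (j : Fin n) :
    0 ≤ G.colPayoff x j :=
  rowPayoff_swap G x j ▸ rowPayoff_nonneg _ _ _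

lemma colPayoff_le_one {n : ℕ} (G : BimatrixGame n) (x : MixedStrategy n) (j : Fin n) :
    G.colPayoff x j ≤ 1 :=
  rowPayoff_swap G x j ▸ rowPayoff_le_one _ _ _

lemma isWSNE_of_forall_le {n : ℕ} {G : BimatrixGame n} {δ : ℝ} {x y : MixedStrategy n}
    (hR : ∀ i, 0 < x.1 i → ∀ a, G.rowPayoff y a ≤ G.rowPayoff y i + δ)
    (hC : ∀ j, 0 < y.1 j → ∀ b, G.colPayoff x b ≤ G.colPayoff x j + δ) : G.IsWSNE δ x y := by
  constructor
  · intro i hi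
    have : Nonempty (Fin n) := ⟨i⟩
    have := ciSup_le (hR i hi)
    unfold IsRowApproxBestResponse
    linarith
  · intro j hj
    have : Nonempty (Fin n) := ⟨j⟩
    have := ciSup_le (hC j hj)
    unfold IsColApproxBestResponse
    linarith

lemma isWSNE_of_one_le {n : ℕ} (G : BimatrixGame n) {δ : ℝ} (hδ : 1 ≤ δ)
    (x y : MixedStrategy n) : G.IsWSNE δ x y :=
  isWSNE_of_forall_le
    (fun i _ a => by linarith [G.rowPayoff_le_one y a, G.rowPayoff_nonneg y i])
    (fun j _ b => by linarith [G.colPayoff_le_one x b, G.colPayoff_nonneg x j])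

lemma IsWSNE.mono {n : ℕ} {G : BimatrixGame n} {δ δ' : ℝ} {x y : MixedStrategy n}
    (h : G.IsWSNE δ x y) (hδ : δ ≤ δ') : G.IsWSNE δ' x y :=
  ⟨fun i hi => (h.1 i hi).trans hδ, fun j hj => (h.2 j hj).trans hδ⟩

/-- `(x, y)` is a `δ`-WSNE of every game whose payoffs agree with those of `G` under the pure
profiles satisfying `P`. -/
def IsCertifiedWSNE {n : ℕ} (G : BimatrixGame n) (P : Fin n → Fin n → Prop) (δ : ℝ)
    (x y : MixedStrategy n) : Prop :=
  ∀ G' : BimatrixGame n, (∀ i j, P i j → G'.R i j = G.R i j ∧ G'.C i j = G.C i j) →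
    G'.IsWSNE δ x y

lemma IsCertifiedWSNE.mono {n : ℕ} {G : BimatrixGame n} {P Q : Fin n → Fin n → Prop} {δ : ℝ}
    {x y : MixedStrategy n} (h : G.IsCertifiedWSNE P δ x y) (hPQ : ∀ i j, P i j → Q i j) :
    G.IsCertifiedWSNE Q δ x y :=
  fun G' hG' => h G' fun i j hij => hG' i j (hPQ i j hij)

lemma IsCertifiedWSNE.of_swap {n : ℕ} {G : BimatrixGame n} {P : Fin n → Fin n → Prop} {δ : ℝ}
    {x y : MixedStrategy n} (h : G.swap.IsCertifiedWSNE (fun j i => P i j) δ y x) :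
    G.IsCertifiedWSNE P δ x y :=
  fun G' hG' => isWSNE_swap.1 <| h G'.swap fun j i hij => (hG' i j hij).symm

lemma rowPayoff_congr {n : ℕ} {G G' : BimatrixGame n} {y : MixedStrategy n} {i : Fin n}
    (h : ∀ j, 0 < y.1 j → G'.R i j = G.R i j) : G'.rowPayoff y i = G.rowPayoff y i :=
  Finset.sum_congr rfl fun j _ => by
    rcases (y.2.1 j).eq_or_lt with h0 | h0
    · rw [← h0]; simp
    · rw [h j h0]

lemma colPayoff_congr {n : ℕ} {G G' : BimatrixGame n} {x : MixedStrategy n} {j : Fin n}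
    (h : ∀ i, 0 < x.1 i → G'.C i j = G.C i j) : G'.colPayoff x j = G.colPayoff x j := by
  rw [← rowPayoff_swap, ← rowPayoff_swap]
  exact rowPayoff_congr h

/-- Knowledge of the rows in the support of `x` certifies a WSNE where these rows earn at least
`1 - δ`. -/
lemma isCertifiedWSNE_of_payoff_ge {n : ℕ} {G : BimatrixGame n} {P : Fin n → Fin n → Prop}
    {δ : ℝ} {x y : MixedStrategy n} (hP : ∀ i j, 0 < x.1 i → P i j)
    (hR : ∀ i, 0 < x.1 i → 1 - δ ≤ G.rowPayoff y i)
    (hC : ∀ j, 0 < y.1 j → ∀ b, G.colPayoff x b ≤ G.colPayoff x j + δ) :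
    G.IsCertifiedWSNE P δ x y := by
  intro G' hG'
  have hcol : ∀ j, G'.colPayoff x j = G.colPayoff x j := fun j =>
    colPayoff_congr fun i hi => (hG' i j (hP i j hi)).2
  refine isWSNE_of_forall_le (fun i hi a => ?_) (by simpa only [hcol] using hC)
  rw [rowPayoff_congr fun j _ => (hG' i j (hP i j hi)).1]
  linarith [hR i hi, G'.rowPayoff_le_one y a]

/-- Knowledge of the rows in the support of `x` and of the columns in the support of `y` certifies
a WSNE where no column earns more than `δ`. -/
lemma isCertifiedWSNE_of_colPayoff_le {n : ℕ} {G : BimatrixGame n} {P : Fin n → Fin n → Prop}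
    {δ : ℝ} {x y : MixedStrategy n} (hx : ∀ i j, 0 < x.1 i → P i j)
    (hy : ∀ i j, 0 < y.1 j → P i j)
    (hR : ∀ i, 0 < x.1 i → ∀ a, G.rowPayoff y a ≤ G.rowPayoff y i + δ)
    (hC : ∀ j, G.colPayoff x j ≤ δ) :
    G.IsCertifiedWSNE P δ x y := by
  intro G' hG'
  have hcol : ∀ j, G'.colPayoff x j = G.colPayoff x j := fun j =>
    colPayoff_congr fun i hi => (hG' i j (hx i j hi)).2
  have hrow : ∀ i, G'.rowPayoff y i = G.rowPayoff y i := fun i =>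
    rowPayoff_congr fun j hj => (hG' i j (hy i j hj)).1
  refine isWSNE_of_forall_le (by simpa only [hrow] using hR) fun j _ b => ?_
  rw [hcol, hcol]
  linarith [hC b, G.colPayoff_nonneg x j]

lemma colPayoff_empirical {n : ℕ} (G : BimatrixGame n) (L : List (Fin n)) (h : L ≠ [])
    (j : Fin n) :
    G.colPayoff (.empirical L h) j = (L.map fun i => G.C i j).sum / L.length :=
  MixedStrategy.sum_empirical_mul L h fun i => G.C i j

lemma rowPayoff_empirical {n : ℕ} (G : BimatrixGame n) (L : List (Fin n)) (h : L ≠ [])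
    (i : Fin n) :
    G.rowPayoff (.empirical L h) i = (L.map fun j => G.R i j).sum / L.length := by
  rw [← colPayoff_swap, colPayoff_empirical]
  rfl

/-! ### From zero-sum solutions to a certified 0.6528-WSNE. -/

/-- A strategy `x` securing `0.65` for the row player, some column earning more than `0.6528`
against `x`: the rows in the support of `x` yield a `0.6528`-WSNE. -/
theorem exists_isCertifiedWSNE_of_secure {n : ℕ} {G : BimatrixGame n}
    {P : Fin n → Fin n → Prop} {x : MixedStrategy n} (hP : ∀ i j, 0 < x.1 i → P i j)
    (hsec : ∀ j, 0.65 ≤ ∑ i, x.1 i * G.R i j) {p : Fin n} (hp : 0.6528 < G.colPayoff x p) :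
    ∃ x' y', G.IsCertifiedWSNE P 0.6528 x' y' := by
  -- Here 0.3472 = 1 - 0.6528: a strategy earning this much has regret at most 0.6528, whatever the
  -- rest of the game looks like.
  by_cases hpure : ∃ i j, 0 < x.1 i ∧ 0.3472 ≤ G.R i j ∧ 0.3472 ≤ G.C i j
  · obtain ⟨i, j, hi, hR, hC⟩ := hpure
    refine ⟨.empirical [i] (by simp), .empirical [j] (by simp),
      isCertifiedWSNE_of_payoff_ge (fun a b ha => ?_) (fun a ha => ?_) fun b hb c => ?_⟩
    · obtain rfl : a = i := by simpa using MixedStrategy.mem_of_empirical_pos ha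
      exact hP _ _ hi
    · obtain rfl : a = i := by simpa using MixedStrategy.mem_of_empirical_pos ha
      simp only [rowPayoff_empirical, List.map_cons, List.map_nil, List.sum_cons, List.sum_nil,
        List.length_cons, List.length_nil]
      norm_num at hR ⊢
      exact hR
    · obtain rfl : b = j := by simpa using MixedStrategy.mem_of_empirical_pos hb
      refine (G.colPayoff_le_one _ c).trans ?_
      simp only [colPayoff_empirical, List.map_cons, List.map_nil, List.sum_cons, List.sum_nil,
        List.length_cons, List.length_nil]
      norm_num at hC ⊢
      linarith
  push Not at hpure
  set B := Finset.univ.filter fun i => 0.3472 ≤ G.R i p with hB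
  set S := Finset.univ.filter fun i => ¬ 0.3472 ≤ G.R i p with hS
  have hsplit : ∀ f : Fin n → ℝ, ∑ i, x.1 i * f i = ∑ i ∈ B, x.1 i * f i + ∑ i ∈ S, x.1 i * f i :=
    fun f => (Finset.sum_filter_add_sum_filter_not _ _ _).symm
  have hmass : ∑ i ∈ B, x.1 i + ∑ i ∈ S, x.1 i = 1 :=
    (Finset.sum_filter_add_sum_filter_not _ _ _).trans x.2.2
  -- weighted comparison of sums over a set of rows
  have hle : ∀ (Q : Finset (Fin n)) (f g : Fin n → ℝ), (∀ i ∈ Q, 0 < x.1 i → f i ≤ g i) →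
      ∑ i ∈ Q, x.1 i * f i ≤ ∑ i ∈ Q, x.1 i * g i := fun Q f g h =>
    Finset.sum_le_sum fun i hi => by
      rcases (x.2.1 i).eq_or_lt with h0 | h0
      · rw [← h0]; simp
      · exact mul_le_mul_of_nonneg_left (h i hi h0) h0.le
  have hconst : ∀ (Q : Finset (Fin n)) (c : ℝ), ∑ i ∈ Q, x.1 i * c = c * ∑ i ∈ Q, x.1 i :=
    fun Q c => by rw [← Finset.sum_mul, mul_comm]
  have hBC : ∀ i ∈ B, 0 < x.1 i → G.C i p ≤ 0.3472 := fun i hi h0 =>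
    (hpure i p h0 (by simpa [hB] using hi)).le
  have h1 := hsec p
  have h2 := hp
  rw [colPayoff, hsplit fun i => G.C i p] at h2
  rw [hsplit fun i => G.R i p] at h1
  have h3 := hle S (fun i => G.R i p) (fun _ => 0.3472) fun i hi _ => by
    have : ¬ 0.3472 ≤ G.R i p := by simpa [hS] using hi
    exact (not_le.1 this).le
  have h4 := hle B (fun i => G.R i p) (fun _ => 1) fun i _ _ => (G.R_mem i p).2
  have h5 := hle B (fun i => G.C i p) (fun _ => 0.3472) hBC
  have h6 := hle S (fun i => G.C i p) (fun _ => 1) fun i _ _ => (G.C_mem i p).2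
  rw [hconst] at h3 h4 h5 h6
  -- Writing μ for the mass of `B`, security in column `p` gives 0.65 ≤ μ + 0.3472(1 - μ), so μ >
  -- 0.46.
  have hBpos : 0 < ∑ i ∈ B, x.1 i := by linarith
  by_cases hBp : ∀ j, ∑ i ∈ B, x.1 i * G.C i j ≤
      ∑ i ∈ B, x.1 i * G.C i p + 0.6528 * ∑ i ∈ B, x.1 i
  · refine ⟨x.conditioned B hBpos, .empirical [p] (by simp),
      isCertifiedWSNE_of_payoff_ge (fun a b ha => ?_) (fun a ha => ?_) fun b hb c => ?_⟩
    · exact hP _ _ (MixedStrategy.mem_of_conditioned_pos ha).2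
    · have : 0.3472 ≤ G.R a p := by
        simpa [hB] using (MixedStrategy.mem_of_conditioned_pos ha).1
      simp only [rowPayoff_empirical, List.map_cons, List.map_nil, List.sum_cons, List.sum_nil,
        List.length_cons, List.length_nil]
      norm_num at this ⊢
      exact this
    · obtain rfl : b = p := by simpa using MixedStrategy.mem_of_empirical_pos hb
      rw [colPayoff, colPayoff, MixedStrategy.sum_conditioned_mul,
        MixedStrategy.sum_conditioned_mul, div_add' _ _ _ hBpos.ne']
      exact div_le_div_of_nonneg_right (hBp c) hBpos.le
  push Not at hBp
  obtain ⟨q, hq⟩ := hBp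
  have h7 := hsec q
  rw [hsplit fun i => G.R i q] at h7
  have h8 := hle B (fun i => G.R i q) (fun i => 0.3472 + (1 - G.C i q)) fun i _ h0 => by
    -- If the row player does well at `(i, q)`, the column player does not, and the right-hand side
    -- exceeds 1.
    by_cases hR : 0.3472 ≤ G.R i q
    · linarith [hpure i q h0 hR, (G.R_mem i q).2]
    · linarith [(G.C_mem i q).2]
  -- a row in `Q` with small total deficit
  have hex : ∀ (Q : Finset (Fin n)) (f g : Fin n → ℝ),
      1.6944 * ∑ i ∈ Q, x.1 i < ∑ i ∈ Q, x.1 i * f i + ∑ i ∈ Q, x.1 i * g i →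
      ∃ i ∈ Q, 0 < x.1 i ∧ 1.6944 ≤ f i + g i := by
    intro Q f g h
    by_contra! hcon
    have := hle Q (fun i => f i + g i) (fun _ => 1.6944) fun i hi h0 => (hcon i hi h0).le
    rw [hconst] at this
    simp only [mul_add, Finset.sum_add_distrib] at this
    linarith
  simp only [mul_add, mul_sub, Finset.sum_add_distrib, Finset.sum_sub_distrib] at h8
  rw [hconst, hconst] at h8
  -- The threshold is 1.6944 = 1 + 2 · 0.3472. The column payoff of `p` on `B` exceeds μ - 0.3472,
  -- and that of `q` is larger by more than 0.6528μ; with the security bound in `p` the total is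
  -- above 2μ - 0.0444.
  obtain ⟨b, hb, hb0, hbs⟩ := hex B (fun i => G.R i p) (fun i => G.C i q) (by linarith)
  -- Security in `q` together with `h8` bounds the row payoff on `S`. The column payoff of `p` on
  -- `B` cancels, leaving a total above 1.3028 - 0.6944μ, which is enough because μ > 0.3916.
  obtain ⟨s, hs, hs0, hss⟩ := hex S (fun i => G.C i p) (fun i => G.R i q) (by linarith)
  -- Matching pennies: the row player gains at `(b, p)` and `(s, q)`, the column player at `(s, p)`
  -- and `(b, q)`. Each of these payoffs is at least 0.6944, hence each pure strategy earns at least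
  -- 0.3472 against the uniform opponent.
  refine ⟨.empirical [b, s] (by simp), .empirical [p, q] (by simp),
    isCertifiedWSNE_of_payoff_ge (fun i j hi => ?_) (fun i hi => ?_) fun j hj c => ?_⟩
  · have : i = b ∨ i = s := by simpa using MixedStrategy.mem_of_empirical_pos hi
    rcases this with rfl | rfl <;> exact hP _ _ (by assumption)
  · have : i = b ∨ i = s := by simpa using MixedStrategy.mem_of_empirical_pos hi
    simp only [rowPayoff_empirical, List.map_cons, List.map_nil, List.sum_cons, List.sum_nil,
      List.length_cons, List.length_nil]
    norm_num
    rcases this with rfl | rfl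
    · linarith [(G.C_mem i q).2, (G.R_mem i q).1]
    · linarith [(G.C_mem i p).2, (G.R_mem i p).1]
  · have : j = p ∨ j = q := by simpa using MixedStrategy.mem_of_empirical_pos hj
    refine (G.colPayoff_le_one _ c).trans ?_
    simp only [colPayoff_empirical, List.map_cons, List.map_nil, List.sum_cons, List.sum_nil,
      List.length_cons, List.length_nil]
    norm_num
    rcases this with rfl | rfl
    · linarith [(G.R_mem s q).2, (G.C_mem b j).1]
    · linarith [(G.R_mem b p).2, (G.C_mem s j).1]

/-- If `(x, y)` is an approximate equilibrium of the zero-sum game given by `R`, whose value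
exceeds `0.6528`, then knowledge of the rows and columns in its support yields a
`0.6528`-WSNE. -/
theorem exists_isCertifiedWSNE_of_lt {n : ℕ} {G : BimatrixGame n} {P : Fin n → Fin n → Prop}
    {x y : MixedStrategy n} (hx : ∀ i j, 0 < x.1 i → P i j) (hy : ∀ i j, 0 < y.1 j → P i j)
    (hgap : ∀ a j, G.rowPayoff y a ≤ ∑ i, x.1 i * G.R i j + 0.001) {a : Fin n}
    (ha : 0.6528 < G.rowPayoff y a) :
    ∃ x' y', G.IsCertifiedWSNE P 0.6528 x' y' := by
  have : Nonempty (Fin n) := ⟨a⟩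
  obtain ⟨m, hm⟩ := Finite.exists_max (G.rowPayoff y)
  have hmv : 0.6528 < G.rowPayoff y m := ha.trans_le (hm a)
  set Q := Finset.univ.filter fun i => G.rowPayoff y m ≤ G.rowPayoff y i + 0.6528 with hQ
  set N := Finset.univ.filter fun i => ¬ G.rowPayoff y m ≤ G.rowPayoff y i + 0.6528 with hN
  have hsplit : ∀ f : Fin n → ℝ, ∑ i ∈ Q, x.1 i * f i + ∑ i ∈ N, x.1 i * f i = ∑ i, x.1 i * f i :=
    fun f => Finset.sum_filter_add_sum_filter_not _ _ _
  have hmass : ∑ i ∈ Q, x.1 i + ∑ i ∈ N, x.1 i = 1 :=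
    (Finset.sum_filter_add_sum_filter_not _ _ _).trans x.2.2
  have hconst : ∀ (Q : Finset (Fin n)) (c : ℝ), ∑ i ∈ Q, x.1 i * c = c * ∑ i ∈ Q, x.1 i :=
    fun Q c => by rw [← Finset.sum_mul, mul_comm]
  have havg : G.rowPayoff y m ≤ ∑ i, x.1 i * G.rowPayoff y i + 0.001 := by
    have h1 : ∑ i, x.1 i * G.rowPayoff y i = ∑ j, y.1 j * ∑ i, x.1 i * G.R i j := by
      simp only [rowPayoff, Finset.mul_sum]
      rw [Finset.sum_comm]
      exact Finset.sum_congr rfl fun _ _ => Finset.sum_congr rfl fun _ _ => by ring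
    have h2 : ∑ j, y.1 j * (G.rowPayoff y m - 0.001) ≤ ∑ j, y.1 j * ∑ i, x.1 i * G.R i j :=
      Finset.sum_le_sum fun j _ =>
        mul_le_mul_of_nonneg_left (by linarith [hgap m j]) (y.2.1 j)
    rw [← Finset.sum_mul, y.2.2, one_mul] at h2
    linarith
  have h1 : ∑ i ∈ Q, x.1 i * G.rowPayoff y i ≤ ∑ i ∈ Q, x.1 i * G.rowPayoff y m :=
    Finset.sum_le_sum fun i _ => mul_le_mul_of_nonneg_left (hm i) (x.2.1 i)
  have h2 : ∑ i ∈ N, x.1 i * G.rowPayoff y i ≤ ∑ i ∈ N, x.1 i * (G.rowPayoff y m - 0.6528) :=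
    Finset.sum_le_sum fun i hi => mul_le_mul_of_nonneg_left
      (by have : ¬ G.rowPayoff y m ≤ G.rowPayoff y i + 0.6528 := by simpa [hN] using hi
          linarith) (x.2.1 i)
  rw [hconst] at h1 h2
  -- Rows in `N` fall short of the best payoff by more than 0.6528, yet the average shortfall under
  -- `x` is at most 0.001.
  have hNle : 0.6528 * ∑ i ∈ N, x.1 i ≤ 0.001 := by
    have h3 := hsplit (G.rowPayoff y)
    have h4 : G.rowPayoff y m * ∑ i ∈ Q, x.1 i + G.rowPayoff y m * ∑ i ∈ N, x.1 i =
      G.rowPayoff y m := by rw [← mul_add, hmass, mul_one]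
    linarith
  have hQpos : 0 < ∑ i ∈ Q, x.1 i := by linarith
  have hNnn : 0 ≤ ∑ i ∈ N, x.1 i := Finset.sum_nonneg fun i _ => x.2.1 i
  have hP : ∀ i j, 0 < (x.conditioned Q hQpos).1 i → P i j := fun i j hi =>
    hx i j (MixedStrategy.mem_of_conditioned_pos hi).2
  by_cases hcol : ∀ j, G.colPayoff (x.conditioned Q hQpos) j ≤ 0.6528
  · refine ⟨_, y, isCertifiedWSNE_of_colPayoff_le hP hy (fun i hi b => (hm b).trans ?_) hcol⟩
    simpa [hQ] using (MixedStrategy.mem_of_conditioned_pos hi).1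
  · push Not at hcol
    obtain ⟨p, hp⟩ := hcol
    refine exists_isCertifiedWSNE_of_secure hP (fun j => ?_) hp
    -- The secured amount survives as 0.6528 - 0.001 - 0.001/0.6528 > 0.65.
    rw [MixedStrategy.sum_conditioned_mul, le_div_iff₀ hQpos]
    have h3 : ∑ i ∈ N, x.1 i * G.R i j ≤ ∑ i ∈ N, x.1 i * 1 :=
      Finset.sum_le_sum fun i _ => mul_le_mul_of_nonneg_left (G.R_mem i j).2 (x.2.1 i)
    rw [hconst] at h3
    linarith [hsplit fun i => G.R i j, hgap m j]

/-- Approximate equilibria `(x₁, y₁)` and `(x₂, y₂)` of the two zero-sum games given by `R` and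
`C`, with the rows and columns in their supports, yield a `0.6528`-WSNE. -/
theorem exists_isCertifiedWSNE {n : ℕ} {G : BimatrixGame n} {P : Fin n → Fin n → Prop}
    {x₁ y₁ x₂ y₂ : MixedStrategy n} (hx₁ : ∀ i j, 0 < x₁.1 i → P i j)
    (hy₁ : ∀ i j, 0 < y₁.1 j → P i j) (hx₂ : ∀ i j, 0 < x₂.1 i → P i j)
    (hy₂ : ∀ i j, 0 < y₂.1 j → P i j)
    (hR : ∀ a j, G.rowPayoff y₁ a ≤ ∑ i, x₁.1 i * G.R i j + 0.001)
    (hC : ∀ b i, G.colPayoff x₂ b ≤ ∑ j, y₂.1 j * G.C i j + 0.001) :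
    ∃ x y, G.IsCertifiedWSNE P 0.6528 x y := by
  by_cases hrow : ∃ a, 0.6528 < G.rowPayoff y₁ a
  · exact exists_isCertifiedWSNE_of_lt hx₁ hy₁ hR hrow.choose_spec
  by_cases hcol : ∃ b, 0.6528 < G.colPayoff x₂ b
  · obtain ⟨b, hb⟩ := hcol
    obtain ⟨y, x, h⟩ := exists_isCertifiedWSNE_of_lt (G := G.swap) (P := fun j i => P i j)
      (x := y₂) (y := x₂) (fun j i => hy₂ i j) (fun j i => hx₂ i j)
      (fun b i => by rw [rowPayoff_swap]; exact hC b i) (a := b) (by rwa [rowPayoff_swap])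
    exact ⟨x, y, h.of_swap⟩
  push Not at hrow hcol
  -- Against `y₁` no row, and against `x₂` no column, earns more than 0.6528, so all regrets are
  -- small whatever the supports.
  refine ⟨x₂, y₁, isCertifiedWSNE_of_colPayoff_le hx₂ hy₁ (fun i _ a => ?_) hcol⟩
  linarith [hrow a, G.rowPayoff_nonneg y₁ i]

end BimatrixGame

/-! ### Failure probability and query count by recursion on the decision tree. -/

namespace BimatrixGame

/-- The answer to the payoff query `(i, j)`. -/
def payoff {n : ℕ} (G : BimatrixGame n) (i j : Fin n) : ℝ × ℝ := (G.R i j, G.C i j)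

end BimatrixGame

namespace PayoffQueryAlgorithm

/-- The probability that the profile returned by the algorithm violates `W`. -/
noncomputable def failProb {n : ℕ} (G : BimatrixGame n)
    (W : MixedStrategy n → MixedStrategy n → Prop) : PayoffQueryAlgorithm n → ℝ
  | .output x y => open Classical in if W x y then 0 else 1
  | .query i j next => failProb G W (next (G.R i j) (G.C i j))
  | .sample _ p next => ∑ a, (p a).toReal * failProb G W (next a)

lemma sum_toReal_pmf {m : ℕ} (p : PMF (Fin m)) : ∑ a, (p a).toReal = 1 := by
  rw [← ENNReal.toReal_sum fun a _ => p.apply_ne_top a, ← tsum_fintype (L := .unconditional _),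
    p.tsum_coe, ENNReal.toReal_one]

lemma toOuterMeasure_apply_ne_top {α : Type*} (p : PMF α) (s : Set α) :
    p.toOuterMeasure s ≠ ⊤ := by
  refine ((MeasureTheory.measure_mono (Set.subset_univ s)).trans_lt ?_).ne
  rw [(p.toOuterMeasure_apply_eq_one_iff _).2 (Set.subset_univ _)]
  exact ENNReal.one_lt_top

/-- Reduces the probability claim about `run` to the recursively defined `failProb`, which can be
bounded by induction without measure theory. -/
theorem toReal_run_eq {n : ℕ} (G : BimatrixGame n) (W : MixedStrategy n → MixedStrategy n → Prop)
    (A : PayoffQueryAlgorithm n) :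
    ((A.run G).toOuterMeasure {o | W o.x o.y}).toReal = 1 - A.failProb G W := by
  induction A with
  | output x y =>
    by_cases h : W x y <;> simp [run, failProb, h]
  | query i j next ih =>
    rw [run, PMF.toOuterMeasure_map_apply, failProb, ← ih]
    rfl
  | sample m p next ih =>
    rw [run, PMF.toOuterMeasure_bind_apply, failProb, tsum_fintype, ENNReal.toReal_sum]
    · simp only [ENNReal.toReal_mul, ih, mul_sub, mul_one, Finset.sum_sub_distrib, sum_toReal_pmf]
    · exact fun a _ => ENNReal.mul_ne_top (p.apply_ne_top a) (toOuterMeasure_apply_ne_top _ _)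

lemma failProb_le_one {n : ℕ} (G : BimatrixGame n) (W : MixedStrategy n → MixedStrategy n → Prop)
    (A : PayoffQueryAlgorithm n) : A.failProb G W ≤ 1 := by
  linarith [toReal_run_eq G W A, ENNReal.toReal_nonneg
    (a := (A.run G).toOuterMeasure {o | W o.x o.y})]

/-- Every run makes at most `N` queries, whatever the answers. -/
def QueriesLE {n : ℕ} : PayoffQueryAlgorithm n → ℕ → Prop
  | .output _ _, _ => True
  | .query _ _ next, N => ∃ M, N = M + 1 ∧ ∀ r c, QueriesLE (next r c) M
  | .sample _ _ next, N => ∀ a, QueriesLE (next a) N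

theorem queries_le_of_mem_support {n : ℕ} (G : BimatrixGame n) (A : PayoffQueryAlgorithm n) :
    ∀ N, A.QueriesLE N → ∀ o ∈ (A.run G).support, o.queries ≤ N := by
  induction A with
  | output x y =>
    intro N _ o ho
    rw [run, PMF.mem_support_pure_iff] at ho
    simp [ho]
  | query i j next ih =>
    rintro N ⟨M, rfl, hM⟩ o ho
    rw [run, PMF.mem_support_map_iff] at ho
    obtain ⟨o', ho', rfl⟩ := ho
    exact Nat.succ_le_succ (ih _ _ M (hM _ _) o' ho')
  | sample m p next ih =>
    intro N hN o ho
    rw [run, PMF.mem_support_bind_iff] at ho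
    obtain ⟨a, _, ha⟩ := ho
    exact ih a N (hN a) o ha

/-- Query the pure profiles in a list, recording the answers in the table `D`. -/
noncomputable def queryList {n : ℕ} : List (Fin n × Fin n) → (Fin n → Fin n → ℝ × ℝ) →
    ((Fin n → Fin n → ℝ × ℝ) → PayoffQueryAlgorithm n) → PayoffQueryAlgorithm n
  | [], D, k => k D
  | (i, j) :: L, D, k => .query i j fun r c =>
      queryList L (fun a b => if a = i ∧ b = j then (r, c) else D a b) k

lemma queriesLE_queryList {n N : ℕ} {k : (Fin n → Fin n → ℝ × ℝ) → PayoffQueryAlgorithm n}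
    (hk : ∀ D, (k D).QueriesLE N) (L : List (Fin n × Fin n)) (D : Fin n → Fin n → ℝ × ℝ) :
    (queryList L D k).QueriesLE (N + L.length) := by
  induction L generalizing D with
  | nil => exact hk D
  | cons p L ih => exact ⟨N + L.length, by simp [add_assoc], fun r c => ih _⟩

/-- Once the game is fixed, a block of queries is deterministic. Each write stores a true payoff, so
correct entries of the table stay correct. -/
lemma exists_failProb_queryList_eq {n : ℕ} (G : BimatrixGame n)
    (W : MixedStrategy n → MixedStrategy n → Prop) (L : List (Fin n × Fin n))
    (D : Fin n → Fin n → ℝ × ℝ) (k : (Fin n → Fin n → ℝ × ℝ) → PayoffQueryAlgorithm n) :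
    ∃ D' : Fin n → Fin n → ℝ × ℝ,
      (∀ a b, (a, b) ∈ L ∨ D a b = G.payoff a b → D' a b = G.payoff a b) ∧
      (queryList L D k).failProb G W = (k D').failProb G W := by
  induction L generalizing D with
  | nil => exact ⟨D, by simp, rfl⟩
  | cons p L ih =>
    obtain ⟨D', h1, h2⟩ := ih fun a b => if a = p.1 ∧ b = p.2 then G.payoff p.1 p.2 else D a b
    refine ⟨D', fun a b hab => h1 a b ?_, h2⟩
    by_cases hp : a = p.1 ∧ b = p.2
    · right
      rw [if_pos hp, hp.1, hp.2]
    · rw [if_neg hp]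
      refine hab.imp_left fun h => ?_
      rcases List.mem_cons.1 h with h | h
      · exact absurd ⟨congrArg Prod.fst h, congrArg Prod.snd h⟩ hp
      · exact h

end PayoffQueryAlgorithm

/-! ### Exponential potentials and one round of multiplicative weights. -/

/-- The distribution on `Fin n` with probabilities proportional to `exp (w i)`. -/
noncomputable def softmax {n : ℕ} [NeZero n] (w : Fin n → ℝ) : PMF (Fin n) :=
  PMF.ofFintype (fun i => ENNReal.ofReal (Real.exp (w i) / ∑ k, Real.exp (w k))) <| by
    have h : 0 < ∑ k, Real.exp (w k) :=
      Finset.sum_pos (fun _ _ => Real.exp_pos _) Finset.univ_nonempty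
    rw [← ENNReal.ofReal_sum_of_nonneg fun i _ => by positivity, ← Finset.sum_div,
      div_self h.ne', ENNReal.ofReal_one]

lemma sum_exp_mul_toReal_softmax {n : ℕ} [NeZero n] (w : Fin n → ℝ) (i : Fin n) :
    (∑ k, Real.exp (w k)) * (softmax w i).toReal = Real.exp (w i) := by
  have h : 0 < ∑ k, Real.exp (w k) :=
    Finset.sum_pos (fun _ _ => Real.exp_pos _) Finset.univ_nonempty
  rw [softmax, PMF.ofFintype_apply, ENNReal.toReal_ofReal (by positivity),
    mul_div_cancel₀ _ h.ne']

/-- The total payoff of row `i` against a list of columns. -/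
def rowScore {n : ℕ} (M : Fin n → Fin n → ℝ) (J : List (Fin n)) (i : Fin n) : ℝ :=
  (J.map fun j => M i j).sum

/-- The total payoff of a list of rows in column `j`. -/
def colScore {n : ℕ} (M : Fin n → Fin n → ℝ) (I : List (Fin n)) (j : Fin n) : ℝ :=
  (I.map fun i => M i j).sum

/-- The exponential potential of the row player after the columns `J`. -/
noncomputable def rowPotential {n : ℕ} (M : Fin n → Fin n → ℝ) (α : ℝ) (J : List (Fin n)) : ℝ :=
  ∑ i, Real.exp (α * rowScore M J i)

/-- The exponential potential of the column player after the rows `I`. -/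
noncomputable def colPotential {n : ℕ} (M : Fin n → Fin n → ℝ) (α : ℝ) (I : List (Fin n)) : ℝ :=
  ∑ j, Real.exp (-(α * colScore M I j))

lemma rowPotential_nonneg {n : ℕ} (M : Fin n → Fin n → ℝ) (α : ℝ) (J : List (Fin n)) :
    0 ≤ rowPotential M α J :=
  Finset.sum_nonneg fun _ _ => (Real.exp_pos _).le

lemma colPotential_nonneg {n : ℕ} (M : Fin n → Fin n → ℝ) (α : ℝ) (I : List (Fin n)) :
    0 ≤ colPotential M α I :=
  Finset.sum_nonneg fun _ _ => (Real.exp_pos _).le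

/-- The softmax weights are the normalised summands of the potential, so its growth factor is an
average under the sampling distribution. -/
lemma rowPotential_cons {n : ℕ} [NeZero n] (M : Fin n → Fin n → ℝ) (α : ℝ) (J : List (Fin n))
    (j : Fin n) :
    rowPotential M α (j :: J) = rowPotential M α J *
      ∑ i, ((softmax fun i => α * rowScore M J i) i).toReal * Real.exp (α * M i j) := by
  rw [Finset.mul_sum]
  refine Finset.sum_congr rfl fun i _ => ?_
  rw [← mul_assoc, rowPotential, sum_exp_mul_toReal_softmax fun i => α * rowScore M J i,
    ← Real.exp_add, rowScore, rowScore, List.map_cons, List.sum_cons, mul_add, add_comm]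

lemma colPotential_cons {n : ℕ} [NeZero n] (M : Fin n → Fin n → ℝ) (α : ℝ) (I : List (Fin n))
    (i : Fin n) :
    colPotential M α (i :: I) = colPotential M α I *
      ∑ j, ((softmax fun j => -(α * colScore M I j)) j).toReal * Real.exp (-(α * M i j)) := by
  rw [Finset.mul_sum]
  refine Finset.sum_congr rfl fun j _ => ?_
  rw [← mul_assoc, colPotential, sum_exp_mul_toReal_softmax fun j => -(α * colScore M I j),
    ← Real.exp_add, colScore, colScore, List.map_cons, List.sum_cons, mul_add, neg_add, add_comm]

lemma exp_mul_le {α r : ℝ} (hα : |α| ≤ 1) (hr : r ∈ Set.Icc (0 : ℝ) 1) :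
    Real.exp (α * r) ≤ 1 + α ^ 2 + α * r := by
  have h1 : |α * r| ≤ 1 := by
    rw [abs_mul, abs_of_nonneg hr.1]
    exact mul_le_one₀ hα hr.1 hr.2
  have h2 := (abs_le.1 (Real.abs_exp_sub_one_sub_id_le h1)).2
  have h3 : (α * r) ^ 2 ≤ α ^ 2 := by
    rw [mul_pow]
    exact mul_le_of_le_one_right (sq_nonneg _) (pow_le_one₀ hr.1 hr.2)
  linarith

/-- Averaging `exp (α M)` over a product distribution. -/
lemma sum_mul_sum_exp_le {n : ℕ} {M : Fin n → Fin n → ℝ} (hM : ∀ i j, M i j ∈ Set.Icc (0 : ℝ) 1)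
    {α : ℝ} (hα : |α| ≤ 1) {p q : Fin n → ℝ} (hp : ∀ i, 0 ≤ p i) (hq : ∀ j, 0 ≤ q j)
    (hp1 : ∑ i, p i = 1) (hq1 : ∑ j, q j = 1) :
    ∑ i, ∑ j, p i * q j * Real.exp (α * M i j) ≤
      1 + α ^ 2 + α * ∑ i, ∑ j, p i * q j * M i j := by
  calc _ ≤ ∑ i, ∑ j, p i * q j * (1 + α ^ 2 + α * M i j) :=
        Finset.sum_le_sum fun i _ => Finset.sum_le_sum fun j _ =>
          mul_le_mul_of_nonneg_left (exp_mul_le hα (hM i j)) (mul_nonneg (hp i) (hq j))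
    _ = (∑ i, p i * ∑ j, q j) * (1 + α ^ 2) + α * ∑ i, ∑ j, p i * q j * M i j := by
        simp only [Finset.mul_sum, Finset.sum_mul, ← Finset.sum_add_distrib]
        exact Finset.sum_congr rfl fun i _ => Finset.sum_congr rfl fun j _ => by ring
    _ = _ := by simp only [hq1, mul_one, hp1, one_mul]

/-- One round of sampling multiplies the expected product of the potentials by at most
`(1 + α²)²`. -/
theorem sum_softmax_mul_potential_le {n : ℕ} [NeZero n] {M : Fin n → Fin n → ℝ}
    (hM : ∀ i j, M i j ∈ Set.Icc (0 : ℝ) 1) {α : ℝ} (hα : |α| ≤ 1) (I J : List (Fin n)) :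
    ∑ i, ((softmax fun i => α * rowScore M J i) i).toReal *
        ∑ j, ((softmax fun j => -(α * colScore M I j)) j).toReal *
          (rowPotential M α (j :: J) * colPotential M α (i :: I)) ≤
      (1 + α ^ 2) ^ 2 * (rowPotential M α J * colPotential M α I) := by
  simp only [rowPotential_cons, colPotential_cons]
  set p := fun i => ((softmax fun i => α * rowScore M J i) i).toReal with hp
  set q := fun j => ((softmax fun j => -(α * colScore M I j)) j).toReal with hq
  have hp0 : ∀ i, 0 ≤ p i := fun i => ENNReal.toReal_nonneg
  have hq0 : ∀ j, 0 ≤ q j := fun j => ENNReal.toReal_nonneg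
  have hp1 : ∑ i, p i = 1 := PayoffQueryAlgorithm.sum_toReal_pmf _
  have hq1 : ∑ j, q j = 1 := PayoffQueryAlgorithm.sum_toReal_pmf _
  have h1 := sum_mul_sum_exp_le hM hα hp0 hq0 hp1 hq1
  have h2 := sum_mul_sum_exp_le hM (α := -α) (by rwa [abs_neg]) hp0 hq0 hp1 hq1
  set v := ∑ i, ∑ j, p i * q j * M i j
  have hX : 0 ≤ ∑ i, ∑ j, p i * q j * Real.exp (α * M i j) :=
    Finset.sum_nonneg fun i _ => Finset.sum_nonneg fun j _ =>
      mul_nonneg (mul_nonneg (hp0 i) (hq0 j)) (Real.exp_pos _).le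
  have hY : 0 ≤ ∑ i, ∑ j, p i * q j * Real.exp (-α * M i j) :=
    Finset.sum_nonneg fun i _ => Finset.sum_nonneg fun j _ =>
      mul_nonneg (mul_nonneg (hp0 i) (hq0 j)) (Real.exp_pos _).le
  have hXY := mul_le_mul h1 h2 hY (hX.trans h1)
  -- The first-order terms cancel: `(1 + α² + αv)(1 + α² - αv) = (1 + α²)² - (αv)²`.
  have hle : (∑ i, ∑ j, p i * q j * Real.exp (α * M i j)) *
      (∑ i, ∑ j, p i * q j * Real.exp (-α * M i j)) ≤ (1 + α ^ 2) ^ 2 := by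
    nlinarith [sq_nonneg (α * v)]
  refine le_of_eq_of_le ?_ (mul_le_mul_of_nonneg_right hle
    (mul_nonneg (rowPotential_nonneg M α J) (colPotential_nonneg M α I)))
  have hcomm : ∑ i, ∑ j, p i * q j * Real.exp (α * M i j) =
      ∑ j, q j * ∑ i, p i * Real.exp (α * M i j) := by
    rw [Finset.sum_comm]
    simp only [Finset.mul_sum]
    exact Finset.sum_congr rfl fun j _ => Finset.sum_congr rfl fun i _ => by ring
  have hcomm' : ∑ i, ∑ j, p i * q j * Real.exp (-α * M i j) =
      ∑ i, p i * ∑ j, q j * Real.exp (-(α * M i j)) := by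
    simp only [Finset.mul_sum]
    exact Finset.sum_congr rfl fun j _ => Finset.sum_congr rfl fun i _ => by
      rw [neg_mul, mul_assoc]
  -- The row factor depends only on the sampled `j` and the column factor only on the sampled `i`;
  -- independence of the two samples turns the expected product into a product of expectations.
  rw [hcomm, hcomm', mul_comm (∑ j, q j * _), Finset.sum_mul_sum, Finset.sum_mul]
  refine Finset.sum_congr rfl fun i _ => ?_
  rw [Finset.mul_sum, Finset.sum_mul]
  refine Finset.sum_congr rfl fun j _ => ?_
  simp only [hp, hq]
  ring

/-- A large duality gap makes the product of the potentials large. -/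
lemma exp_gap_le_potential {n : ℕ} (M : Fin n → Fin n → ℝ) (α : ℝ) (I J : List (Fin n))
    (a b : Fin n) :
    Real.exp (α * (rowScore M J a - colScore M I b)) ≤
      rowPotential M α J * colPotential M α I := by
  rw [mul_sub, sub_eq_add_neg, Real.exp_add]
  exact mul_le_mul
    (Finset.single_le_sum (f := fun i => Real.exp (α * rowScore M J i))
      (fun _ _ => (Real.exp_pos _).le) (Finset.mem_univ a))
    (Finset.single_le_sum (f := fun j => Real.exp (-(α * colScore M I j)))
      (fun _ _ => (Real.exp_pos _).le) (Finset.mem_univ b))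
    (Real.exp_pos _).le (rowPotential_nonneg M α J)

/-! ### The sampling algorithm and its failure probability. -/

namespace PayoffQueryAlgorithm

/-- All profiles in row `i` and all profiles in column `j`. -/
def cross {n : ℕ} (i j : Fin n) : List (Fin n × Fin n) :=
  (List.finRange n).map (fun b => (i, b)) ++ (List.finRange n).map fun a => (a, j)

lemma mem_cross {n : ℕ} {i j a b : Fin n} : (a, b) ∈ cross i j ↔ a = i ∨ b = j := by
  simp [cross, eq_comm]

lemma length_cross {n : ℕ} (i j : Fin n) : (cross i j).length = 2 * n := by
  simp [cross, two_mul]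

/-- `T` rounds of multiplicative weights for the zero-sum game with payoffs `f`. In every round,
both players sample a pure strategy from their current weights, and this row and this column are
queried. -/
noncomputable def zeroSumRounds {n : ℕ} [NeZero n] (f : ℝ × ℝ → ℝ) (α : ℝ) :
    ℕ → (Fin n → Fin n → ℝ × ℝ) → List (Fin n) → List (Fin n) →
    ((Fin n → Fin n → ℝ × ℝ) → List (Fin n) → List (Fin n) → PayoffQueryAlgorithm n) →
    PayoffQueryAlgorithm n
  | 0, D, I, J, k => k D I J
  | T + 1, D, I, J, k =>
      .sample n (softmax fun i => α * rowScore (fun i j => f (D i j)) J i) fun i =>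
      .sample n (softmax fun j => -(α * colScore (fun i j => f (D i j)) I j)) fun j =>
      queryList (cross i j) D fun D' => zeroSumRounds f α T D' (i :: I) (j :: J) k

lemma queriesLE_zeroSumRounds {n : ℕ} [NeZero n] {f : ℝ × ℝ → ℝ} {α : ℝ} {N : ℕ}
    {k : (Fin n → Fin n → ℝ × ℝ) → List (Fin n) → List (Fin n) → PayoffQueryAlgorithm n}
    (hk : ∀ D I J, (k D I J).QueriesLE N) (T : ℕ) (D : Fin n → Fin n → ℝ × ℝ)
    (I J : List (Fin n)) : (zeroSumRounds f α T D I J k).QueriesLE (N + T * (2 * n)) := by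
  induction T generalizing D I J with
  | zero => simpa [zeroSumRounds] using hk D I J
  | succ T ih =>
    intro i j
    have := queriesLE_queryList (fun D => ih D (i :: I) (j :: J)) (cross i j) D
    rw [length_cross] at this
    convert this using 1
    ring

/-- Markov's inequality run backwards through the tree: `s` scales the potential into a bound for a
large final gap, `β` absorbs failures of the continuation after a small gap. `E` marks profiles
known from an earlier phase, whose table entries must survive. -/
theorem failProb_zeroSumRounds_le {n : ℕ} [NeZero n] {G : BimatrixGame n}
    {W : MixedStrategy n → MixedStrategy n → Prop} {f : ℝ × ℝ → ℝ} {M : Fin n → Fin n → ℝ}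
    (hfM : ∀ i j, f (G.payoff i j) = M i j) (hM : ∀ i j, M i j ∈ Set.Icc (0 : ℝ) 1)
    {α : ℝ} (hα : |α| ≤ 1) {s β : ℝ} (hs : 0 ≤ s) (E : Fin n → Fin n → Prop)
    {k : (Fin n → Fin n → ℝ × ℝ) → List (Fin n) → List (Fin n) → PayoffQueryAlgorithm n}
    {N : ℕ} (hk : ∀ D I J, I.length = N → J.length = N →
      (∀ a b, a ∈ I ∨ b ∈ J ∨ E a b → D a b = G.payoff a b) →
      (k D I J).failProb G W ≤ rowPotential M α J * colPotential M α I * s + β)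
    (T : ℕ) (D : Fin n → Fin n → ℝ × ℝ) (I J : List (Fin n)) (hI : I.length + T = N)
    (hJ : J.length + T = N) (hD : ∀ a b, a ∈ I ∨ b ∈ J ∨ E a b → D a b = G.payoff a b) :
    (zeroSumRounds f α T D I J k).failProb G W ≤
      rowPotential M α J * colPotential M α I * (((1 + α ^ 2) ^ 2) ^ T * s) + β := by
  induction T generalizing D I J with
  | zero => simpa [zeroSumRounds] using hk D I J hI hJ hD
  | succ T ih =>
    -- The scores involve only sampled columns and rows, which have been queried in full, so the
    -- weights computed from the table are the true ones.
    have hrow : rowScore (fun i j => f (D i j)) J = rowScore M J := funext fun i =>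
      congrArg List.sum <| List.map_congr_left fun j hj => by
          simp only [hD i j (.inr (.inl hj)), hfM]
    have hcol : colScore (fun i j => f (D i j)) I = colScore M I := funext fun j =>
      congrArg List.sum <| List.map_congr_left fun i hi => by
          simp only [hD i j (.inl hi), hfM]
    simp only [zeroSumRounds, failProb, hrow, hcol]
    set p := fun i => ((softmax fun i => α * rowScore M J i) i).toReal with hp
    set q := fun j => ((softmax fun j => -(α * colScore M I j)) j).toReal with hq
    have hp0 : ∀ i, 0 ≤ p i := fun i => ENNReal.toReal_nonneg
    have hq0 : ∀ j, 0 ≤ q j := fun j => ENNReal.toReal_nonneg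
    have hp1 : ∑ i, p i = 1 := sum_toReal_pmf _
    have hq1 : ∑ j, q j = 1 := sum_toReal_pmf _
    set r := ((1 + α ^ 2) ^ 2) ^ T * s with hr
    have hr0 : 0 ≤ r := by positivity
    have hnext : ∀ i j, (queryList (cross i j) D fun D' =>
        zeroSumRounds f α T D' (i :: I) (j :: J) k).failProb G W ≤
        rowPotential M α (j :: J) * colPotential M α (i :: I) * r + β := by
      intro i j
      obtain ⟨D', hD', heq⟩ := exists_failProb_queryList_eq G W (cross i j) D fun D' =>
        zeroSumRounds f α T D' (i :: I) (j :: J) k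
      rw [heq]
      refine ih D' (i :: I) (j :: J) (by simp; omega) (by simp; omega) fun a b hab => hD' a b ?_
      rw [mem_cross]
      simp only [List.mem_cons] at hab
      have := hD a b
      tauto
    calc _ ≤ ∑ i, p i * ∑ j, q j *
          (rowPotential M α (j :: J) * colPotential M α (i :: I) * r + β) :=
          Finset.sum_le_sum fun i _ => mul_le_mul_of_nonneg_left
            (Finset.sum_le_sum fun j _ => mul_le_mul_of_nonneg_left (hnext i j) (hq0 j)) (hp0 i)
      _ = (∑ i, p i * ∑ j, q j * (rowPotential M α (j :: J) * colPotential M α (i :: I))) * r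
          + β := by
          simp only [mul_add, Finset.sum_add_distrib, ← Finset.sum_mul, hq1, one_mul, hp1,
            ← mul_assoc]
      _ ≤ (1 + α ^ 2) ^ 2 * (rowPotential M α J * colPotential M α I) * r + β := by
          gcongr
          exact sum_softmax_mul_potential_le hM hα I J
      _ = _ := by rw [hr, pow_succ]; ring

open Classical in
/-- Return a profile that is a `0.6528`-WSNE of all games agreeing with the table `D` on `P`, if
there is one. -/
noncomputable def outputCertified {n : ℕ} [NeZero n] (D : Fin n → Fin n → ℝ × ℝ)
    (P : Fin n → Fin n → Prop) : PayoffQueryAlgorithm n :=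
  if h : ∃ xy : MixedStrategy n × MixedStrategy n, ∀ G : BimatrixGame n,
      (∀ i j, P i j → G.payoff i j = D i j) → G.IsWSNE 0.6528 xy.1 xy.2 then
    .output h.choose.1 h.choose.2
  else .output (.empirical [0] (by simp)) (.empirical [0] (by simp))

lemma queriesLE_outputCertified {n : ℕ} [NeZero n] (D : Fin n → Fin n → ℝ × ℝ)
    (P : Fin n → Fin n → Prop) : (outputCertified D P).QueriesLE 0 := by
  unfold outputCertified
  split_ifs <;> trivial

lemma failProb_outputCertified {n : ℕ} [NeZero n] {G : BimatrixGame n}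
    {D : Fin n → Fin n → ℝ × ℝ} {P : Fin n → Fin n → Prop}
    (hD : ∀ i j, P i j → D i j = G.payoff i j)
    (h : ∃ x y, G.IsCertifiedWSNE P 0.6528 x y) :
    (outputCertified D P).failProb G (G.IsWSNE 0.6528) = 0 := by
  have hex : ∃ xy : MixedStrategy n × MixedStrategy n, ∀ G' : BimatrixGame n,
      (∀ i j, P i j → G'.payoff i j = D i j) → G'.IsWSNE 0.6528 xy.1 xy.2 := by
    obtain ⟨x, y, hxy⟩ := h
    refine ⟨(x, y), fun G' hG' => hxy G' fun i j hij => ?_⟩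
    have := (hG' i j hij).trans (hD i j hij)
    exact ⟨congrArg Prod.fst this, congrArg Prod.snd this⟩
  rw [outputCertified, dif_pos hex, failProb,
    if_pos (hex.choose_spec G fun i j hij => (hD i j hij).symm)]

/-- Solve the two zero-sum games given by `R` and `C` approximately in `T` rounds each, and
return a `0.6528`-WSNE certified by the answers. -/
noncomputable def wsneAlgorithm (n : ℕ) [NeZero n] (α : ℝ) (T : ℕ) : PayoffQueryAlgorithm n :=
  zeroSumRounds (fun u => u.1) α T (fun _ _ => 0) [] [] fun D I₁ J₁ =>
    -- With payoff `1 - u.2` the same procedure, in which rows maximise, makes rows minimise `C` and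
    -- columns maximise it.
    zeroSumRounds (fun u => 1 - u.2) α T D [] [] fun D I₂ J₂ =>
      outputCertified D fun i j => i ∈ I₂ ∨ j ∈ J₂ ∨ i ∈ I₁ ∨ j ∈ J₁

lemma queriesLE_wsneAlgorithm (n : ℕ) [NeZero n] (α : ℝ) (T : ℕ) :
    (wsneAlgorithm n α T).QueriesLE (4 * n * T) := by
  have := queriesLE_zeroSumRounds (n := n) (f := fun u => u.1) (α := α)
    (k := fun D I₁ J₁ => zeroSumRounds (fun u => 1 - u.2) α T D [] [] fun D I₂ J₂ =>
      outputCertified D fun i j => i ∈ I₂ ∨ j ∈ J₂ ∨ i ∈ I₁ ∨ j ∈ J₁)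
    (fun D I J => queriesLE_zeroSumRounds (fun D I J => queriesLE_outputCertified D _) T D [] [])
    T (fun _ _ => 0) [] []
  rwa [show 0 + T * (2 * n) + T * (2 * n) = 4 * n * T by ring] at this

lemma sum_map_one_sub {ι : Type*} (L : List ι) (f : ι → ℝ) :
    (L.map fun i => 1 - f i).sum = L.length - (L.map f).sum := by
  induction L with
  | nil => simp
  | cons a L ih =>
    simp only [List.map_cons, List.sum_cons, List.length_cons, ih]
    push_cast
    ring

/-- Small duality gaps of the sampled rows and columns yield a certified `0.6528`-WSNE. -/
theorem exists_isCertifiedWSNE_of_gap {n : ℕ} {G : BimatrixGame n} {T : ℕ} (hT : 0 < T)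
    {I₁ J₁ I₂ J₂ : List (Fin n)} (hI₁ : I₁.length = T) (hJ₁ : J₁.length = T)
    (hI₂ : I₂.length = T) (hJ₂ : J₂.length = T)
    (h₁ : ∀ a b, rowScore (fun i j => G.R i j) J₁ a - colScore (fun i j => G.R i j) I₁ b ≤ 0.001 * T)
    (h₂ : ∀ a b, rowScore (fun i j => 1 - G.C i j) J₂ a -
      colScore (fun i j => 1 - G.C i j) I₂ b ≤ 0.001 * T) :
    ∃ x y, G.IsCertifiedWSNE (fun i j => i ∈ I₂ ∨ j ∈ J₂ ∨ i ∈ I₁ ∨ j ∈ J₁) 0.6528 x y := by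
  have hne : ∀ L : List (Fin n), L.length = T → L ≠ [] := fun L hL =>
    List.ne_nil_of_length_pos (hL ▸ hT)
  have hTpos : (0 : ℝ) < T := by exact_mod_cast hT
  refine BimatrixGame.exists_isCertifiedWSNE
    (x₁ := .empirical I₁ (hne _ hI₁)) (y₁ := .empirical J₁ (hne _ hJ₁))
    (x₂ := .empirical I₂ (hne _ hI₂)) (y₂ := .empirical J₂ (hne _ hJ₂))
    (fun i j h => ?_) (fun i j h => ?_) (fun i j h => ?_) (fun i j h => ?_)
    (fun a b => ?_) fun b a => ?_
  · exact .inr (.inr (.inl (MixedStrategy.mem_of_empirical_pos h)))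
  · exact .inr (.inr (.inr (MixedStrategy.mem_of_empirical_pos h)))
  · exact .inl (MixedStrategy.mem_of_empirical_pos h)
  · exact .inr (.inl (MixedStrategy.mem_of_empirical_pos h))
  · have h := h₁ a b
    rw [rowScore, colScore] at h
    rw [BimatrixGame.rowPayoff_empirical, MixedStrategy.sum_empirical_mul I₁ _ fun i => G.R i b,
      hI₁, hJ₁, div_add' _ _ _ hTpos.ne']
    exact div_le_div_of_nonneg_right (by linarith) hTpos.le
  · have h := h₂ a b
    rw [rowScore, colScore, sum_map_one_sub, sum_map_one_sub, hI₂, hJ₂] at h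
    rw [BimatrixGame.colPayoff_empirical, MixedStrategy.sum_empirical_mul J₂ _ fun j => G.C a j,
      hI₂, hJ₂, div_add' _ _ _ hTpos.ne']
    exact div_le_div_of_nonneg_right (by linarith) hTpos.le

/-- If some duality gap exceeds `γ`, the scaled potential bounds every failure probability. -/
lemma failProb_le_potential_of_gap {n : ℕ} {G : BimatrixGame n}
    {W : MixedStrategy n → MixedStrategy n → Prop} {M : Fin n → Fin n → ℝ} {α γ : ℝ} (hα : 0 ≤ α)
    {I J : List (Fin n)} (h : ¬ ∀ a b, rowScore M J a - colScore M I b ≤ γ)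
    (A : PayoffQueryAlgorithm n) :
    A.failProb G W ≤ rowPotential M α J * colPotential M α I * Real.exp (-(α * γ)) := by
  push Not at h
  obtain ⟨a, b, hab⟩ := h
  calc A.failProb G W ≤ 1 := failProb_le_one G W A
    _ ≤ Real.exp (α * (rowScore M J a - colScore M I b)) * Real.exp (-(α * γ)) := by
        rw [← Real.exp_add]
        refine Real.one_le_exp ?_
        linarith [mul_le_mul_of_nonneg_left hab.le hα]
    _ ≤ _ := mul_le_mul_of_nonneg_right (exp_gap_le_potential M α I J a b) (Real.exp_pos _).le

theorem failProb_wsneAlgorithm_le {n : ℕ} [NeZero n] (G : BimatrixGame n) {α : ℝ} (hα0 : 0 ≤ α)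
    (hα1 : α ≤ 1) {T : ℕ} (hT : 0 < T) :
    (wsneAlgorithm n α T).failProb G (G.IsWSNE 0.6528) ≤
      2 * (n ^ 2 * (((1 + α ^ 2) ^ 2) ^ T * Real.exp (-(α * (0.001 * T))))) := by
  have hα : |α| ≤ 1 := by rwa [abs_of_nonneg hα0]
  have hnil : ∀ M : Fin n → Fin n → ℝ,
      rowPotential M α [] * colPotential M α [] = (n : ℝ) ^ 2 := fun M => by
    simp [rowPotential, colPotential, rowScore, colScore, sq]
  set s := Real.exp (-(α * (0.001 * T)))
  have hs : 0 ≤ s := (Real.exp_pos _).le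
  refine le_of_le_of_eq (failProb_zeroSumRounds_le (M := fun i j => G.R i j) (fun _ _ => rfl) G.R_mem hα hs
    (fun _ _ => False) (N := T) (β := n ^ 2 * (((1 + α ^ 2) ^ 2) ^ T * s))
    (fun D I₁ J₁ hI₁ hJ₁ hD => ?_) T _ [] [] (by simp) (by simp) (by simp))
    (by rw [hnil]; ring)
  -- A large first gap is paid for by the potential of the first phase; otherwise the bound for the
  -- second phase, which is the chosen `β`, has to suffice.
  by_cases h₁ : ∀ a b, rowScore (fun i j => G.R i j) J₁ a -
      colScore (fun i j => G.R i j) I₁ b ≤ 0.001 * T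
  · have h0 : 0 ≤ rowPotential (fun i j => G.R i j) α J₁ *
        colPotential (fun i j => G.R i j) α I₁ * s :=
      mul_nonneg (mul_nonneg (rowPotential_nonneg _ _ _) (colPotential_nonneg _ _ _)) hs
    refine le_trans ?_ (le_add_of_nonneg_left h0)
    have hC : ∀ i j, 1 - G.C i j ∈ Set.Icc (0 : ℝ) 1 := fun i j =>
      ⟨sub_nonneg.2 (G.C_mem i j).2, sub_le_self _ (G.C_mem i j).1⟩
    refine le_of_le_of_eq (failProb_zeroSumRounds_le (M := fun i j => 1 - G.C i j)
      (fun _ _ => rfl) hC hα hs (fun i j => i ∈ I₁ ∨ j ∈ J₁) (N := T) (β := 0)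
      (fun D I₂ J₂ hI₂ hJ₂ hD => ?_) T D [] [] (by simp) (by simp)
      fun a b hab => hD a b (by simpa [or_assoc] using hab)) (by rw [hnil, add_zero])
    rw [add_zero]
    by_cases h₂ : ∀ a b, rowScore (fun i j => 1 - G.C i j) J₂ a -
        colScore (fun i j => 1 - G.C i j) I₂ b ≤ 0.001 * T
    · rw [failProb_outputCertified hD
        (exists_isCertifiedWSNE_of_gap hT hI₁ hJ₁ hI₂ hJ₂ h₁ h₂)]
      exact mul_nonneg (mul_nonneg (rowPotential_nonneg _ _ _) (colPotential_nonneg _ _ _)) hs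
    · exact failProb_le_potential_of_gap hα0 h₂ _
  · refine (failProb_le_potential_of_gap hα0 h₁ _).trans (le_add_of_nonneg_right ?_)
    positivity

/-- With `α = 1/4000` and logarithmically many rounds, the failure probability is at most
`n ^ (-c)`. -/
theorem failProb_wsneAlgorithm_le_rpow {n : ℕ} [NeZero n] (hn : 2 ≤ n) (G : BimatrixGame n)
    {c : ℝ} {T : ℕ} (hT0 : 0 < T) (hT : 8000000 * (c + 3) * Real.log n ≤ T) :
    (wsneAlgorithm n (1 / 4000) T).failProb G (G.IsWSNE 0.6528) ≤ (n : ℝ) ^ (-c) := by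
  have hn2 : (2 : ℝ) ≤ n := by exact_mod_cast hn
  have hn0 : (0 : ℝ) < n := by linarith
  refine (failProb_wsneAlgorithm_le G (by norm_num) (by norm_num) hT0).trans ?_
  have h1 : ((1 + (1 / 4000 : ℝ) ^ 2) ^ 2) ^ T ≤ Real.exp (2 * (1 / 4000) ^ 2 * T) := by
    rw [← pow_mul]
    have : (1 + (1 / 4000 : ℝ) ^ 2) ≤ Real.exp ((1 / 4000) ^ 2) := by
      linarith [Real.add_one_le_exp ((1 / 4000 : ℝ) ^ 2)]
    refine (pow_le_pow_left₀ (by norm_num) this _).trans_eq ?_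
    rw [← Real.exp_nat_mul]
    push_cast
    ring_nf
  have h2 : ((1 + (1 / 4000 : ℝ) ^ 2) ^ 2) ^ T * Real.exp (-(1 / 4000 * (0.001 * T))) ≤
      (n : ℝ) ^ (-(c + 3)) := by
    refine (mul_le_mul_of_nonneg_right h1 (Real.exp_pos _).le).trans ?_
    rw [← Real.exp_add, Real.rpow_def_of_pos hn0]
    -- Each round contributes 2α² - 0.001α = -1/8000000 to the exponent, minimal at α = 0.001/4 =
    -- 1/4000; this is the source of the constant in `hT`.
    refine Real.exp_le_exp.2 ?_
    linarith
  calc 2 * ((n : ℝ) ^ 2 * (((1 + (1 / 4000 : ℝ) ^ 2) ^ 2) ^ T *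
        Real.exp (-(1 / 4000 * (0.001 * T)))))
      -- The surplus 3 in the exponent pays for the initial potential `n ^ 2` and, since 2 ≤ n, for
      -- the factor 2 from the two phases.
      ≤ n * ((n : ℝ) ^ 2 * (n : ℝ) ^ (-(c + 3))) := by gcongr
    _ = (n : ℝ) ^ (-c) := by
        rw [← mul_assoc, ← pow_succ', ← Real.rpow_natCast, ← Real.rpow_add hn0]
        congr 1
        push_cast
        ring

end PayoffQueryAlgorithm

/-! ### Choice of the constants. -/

theorem mainTheorem3 (c : ℝ) (hc : 0 < c) :
    ∃ (K : ℝ) (A : ∀ (n : ℕ) [NeZero n], ℝ → PayoffQueryAlgorithm n),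
      ∀ (n : ℕ) [NeZero n] (ε : ℝ), 0 < ε → ∀ G : BimatrixGame n,
        (∀ o ∈ ((A n ε).run G).support, (o.queries : ℝ) ≤ K * (n * Real.log n / ε ^ 2)) ∧
        1 - (n : ℝ) ^ (-c) ≤
          (((A n ε).run G).toOuterMeasure
            {o | G.IsWSNE (0.6528 + ε) o.x o.y}).toReal := by
  set κ : ℝ := 8000000 * (c + 3) with hκ
  refine ⟨4 * (κ + 2), fun n _ ε => if ε < 1 then
    .wsneAlgorithm n (1 / 4000) ⌈κ * Real.log n⌉₊ else .wsneAlgorithm n (1 / 4000) 0, ?_⟩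
  intro n _ ε hε G
  dsimp only
  have hn1 : 1 ≤ n := Nat.one_le_iff_ne_zero.2 (NeZero.ne n)
  have hlog : 0 ≤ Real.log n := Real.log_natCast_nonneg n
  have hκ0 : 0 < κ := by positivity
  by_cases hε1 : ε < 1
  · rw [if_pos hε1]
    -- For n = 1 the logarithm vanishes, so no query is allowed; zero rounds are run, and the
    -- required probability is 0.
    rcases hn1.eq_or_lt with rfl | hn
    · refine ⟨fun o ho => ?_, by simp⟩
      have := PayoffQueryAlgorithm.queries_le_of_mem_support G _ _
        (PayoffQueryAlgorithm.queriesLE_wsneAlgorithm _ _ _) o ho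
      simp at this ⊢
      exact this
    have hn2 : 2 ≤ n := hn
    have hn2' : (2 : ℝ) ≤ n := by exact_mod_cast hn2
    have hlog2 : 1 / 2 ≤ Real.log n := by
      linarith [Real.log_two_gt_d9, Real.log_le_log (by norm_num) hn2']
    have hTpos : 0 < ⌈κ * Real.log n⌉₊ := Nat.ceil_pos.2 (mul_pos hκ0 (by linarith))
    constructor
    · intro o ho
      have h1 : (o.queries : ℝ) ≤ 4 * n * ⌈κ * Real.log n⌉₊ := by
        exact_mod_cast PayoffQueryAlgorithm.queries_le_of_mem_support G _ _
          (PayoffQueryAlgorithm.queriesLE_wsneAlgorithm _ _ _) o ho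
      -- Rounding up costs at most 1, which is at most `2 * Real.log n` for n ≥ 2; hence `κ + 2`.
      have h2 : (⌈κ * Real.log n⌉₊ : ℝ) ≤ (κ + 2) * Real.log n := by
        linarith [Nat.ceil_lt_add_one (mul_nonneg hκ0.le hlog)]
      have h3 : (n : ℝ) * Real.log n ≤ n * Real.log n / ε ^ 2 :=
        le_div_self (by positivity) (by positivity) (pow_le_one₀ hε.le hε1.le)
      calc (o.queries : ℝ) ≤ 4 * n * ((κ + 2) * Real.log n) := h1.trans (by gcongr)
        _ = 4 * (κ + 2) * (n * Real.log n) := by ring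
        _ ≤ _ := by gcongr
    · have h1 := PayoffQueryAlgorithm.failProb_wsneAlgorithm_le_rpow hn2 G hTpos
        (Nat.le_ceil (κ * Real.log n))
      have h2 := PayoffQueryAlgorithm.toReal_run_eq G (G.IsWSNE 0.6528)
        (.wsneAlgorithm n (1 / 4000) ⌈κ * Real.log n⌉₊)
      have hsub : {o : QueryOutcome n | G.IsWSNE 0.6528 o.x o.y} ⊆
          {o | G.IsWSNE (0.6528 + ε) o.x o.y} := fun o ho =>
        BimatrixGame.IsWSNE.mono ho (by linarith)
      exact le_trans (by linarith) (ENNReal.toReal_mono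
        (PayoffQueryAlgorithm.toOuterMeasure_apply_ne_top _ _) (MeasureTheory.measure_mono hsub))
  · rw [if_neg hε1]
    constructor
    · intro o ho
      have := PayoffQueryAlgorithm.queries_le_of_mem_support G _ _
        (PayoffQueryAlgorithm.queriesLE_wsneAlgorithm _ _ _) o ho
      have h0 : (o.queries : ℝ) ≤ 0 := by exact_mod_cast this
      exact h0.trans (by positivity)
    · have huniv : {o : QueryOutcome n | G.IsWSNE (0.6528 + ε) o.x o.y} = Set.univ :=
        Set.eq_univ_of_forall fun o => G.isWSNE_of_one_le (by linarith) o.x o.y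
      rw [huniv, (PMF.toOuterMeasure_apply_eq_one_iff _ _).2 (Set.subset_univ _),
        ENNReal.toReal_one, sub_le_self_iff]
      positivity
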